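/- **Theorem 1.3 (Fourier decay of random Cantor measures).** For natural numbers $A\le M$ let $\mathcal A(M,A)$ be the set of all $\mathcal A\subset\{0,\dots,M-1\}$ with exactly $A$ elements, with its uniform probability measure, and let $\mathcal A^\infty=\prod_{j\ge1}\mathcal A(M,A)^{A^{j-1}}$ with the product probability measure $\mu^\infty$. A point of $\mathcal A^\infty$ defines finite sets $B_0=\{0\}$ and $$B_j=\bigcup_{b\in B_{j-1}}\Big\{b+\frac a{M^j}: a\in\mathcal A(b)\Big\}\qquad(j\ge1),$$ where $\mathcal A(b)$, for $b$ the $k$-th smallest element of $B_{j-1}$, is the $k$-th of the $A^{j-1}$ alphabets in the $j$-th factor (so $B_j$ has $A^j$ elements and all alphabets are independent and uniform). Put $\mathcal C_j=\bigcup_{b\in B_j}[b,b+M^{-j}]$, let $\nu_j$ be the measure on $\mathbb R$ with density $\frac{M^j}{A^j}\mathbf 1_{\mathcal C_j}$, and let the random Cantor measure $\nu$ be the weak limit of $\nu_j$ as $j\to\infty$. Write $\mathcal F\nu(\xi)=\frac1{\sqrt{2\pi}}\int_{\mathbb R}e^{-ix\xi}\,d\nu(x)$. There are an absolute constant $C>0$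 and, for each $\varepsilon>0$, a constant $C_1=C_1(\varepsilon)>0$ depending only on $\varepsilon$, such that the following holds. Let $0<\delta<1$, let $M,A\in\mathbb N$ satisfy $M\ge e^{4/\delta}$ and $A=M^\delta$, and let $0<\varepsilon<\min\{\frac\delta2,\frac13\}$. Then there is a measurable set $G\subset\mathcal A^\infty$ with $$\mu^\infty(\mathcal A^\infty\setminus G)\le C_1 e^{-M^\varepsilon/C}$$ such that for each point of $G$ the weak limit $\nu$ exists, is a probability measure, and satisfies $$|\mathcal F\nu(\xi)|\le C|\xi|^{-\frac{\delta-\varepsilon}2}\qquad\text{for all real }\xi\text{ with }|\xi|\ge M^4.$$ -/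

import Mathlib

open Filter Topology MeasureTheory
open scoped BoundedContinuousFunction

namespace RandomCantor

/-- The alphabets of cardinality `A` from the digits `{0, ..., M - 1}`. -/
def Alphabet (M A : ℕ) : Type := {s : Finset (Fin M) // s.card = A}

noncomputable instance (M A : ℕ) : Fintype (Alphabet M A) :=
  inferInstanceAs (Fintype {s : Finset (Fin M) // s.card = A})

/-- Every set of alphabets is an event. -/
instance (M A : ℕ) : MeasurableSpace (Alphabet M A) := ⊤

instance (M A : ℕ) : DiscreteMeasurableSpace (Alphabet M A) := ⟨fun _ => trivial⟩

theorem Alphabet.nonempty {M A : ℕ} (h : A ≤ M) : Nonempty (Alphabet M A) := by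
  obtain ⟨s, -, hs⟩ := Finset.exists_subset_card_eq
    (s := (Finset.univ : Finset (Fin M))) (n := A) (by simpa using h)
  exact ⟨⟨s, hs⟩⟩

/-- The `r`-th smallest digit of an alphabet, for `r = 0, ..., A - 1`. -/
noncomputable def Alphabet.digit {M A : ℕ} (s : Alphabet M A) (r : Fin A) : Fin M :=
  s.1.orderEmbOfFin s.2 r

/-- The sample space of the random Cantor sets: the product over `j = 0, 1, 2, ...` of the spaces
of families of `A ^ j` alphabets. The alphabet `ω j k` is the one attached to the `k`-th smallest
element of the `j`-th set of left endpoints. -/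
abbrev SampleSpace (M A : ℕ) : Type := ∀ j : ℕ, Fin (A ^ j) → Alphabet M A

/-- The uniform probability measure on the alphabets. -/
noncomputable def alphabetMeasure (M A : ℕ) : Measure (Alphabet M A) :=
  ProbabilityTheory.uniformOn Set.univ

/-- The product measure on the sample space: all alphabets are independent and uniform. -/
noncomputable def sampleMeasure (M A : ℕ) : Measure (SampleSpace M A) :=
  Measure.infinitePi fun j : ℕ => Measure.pi fun _ : Fin (A ^ j) => alphabetMeasure M A

instance (M A : ℕ) [Nonempty (Alphabet M A)] : IsProbabilityMeasure (alphabetMeasure M A) := by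
  unfold alphabetMeasure; infer_instance

instance (M A : ℕ) [Nonempty (Alphabet M A)] : IsProbabilityMeasure (sampleMeasure M A) := by
  unfold sampleMeasure; infer_instance

/-- The increasing enumeration of the left endpoints of the `A ^ j` intervals of length `M⁻ʲ` kept
after `j` iterations. The start is the interval `[0, 1]`; the interval with left endpoint `b` is
replaced by those with left endpoints `b + a / M ^ (j + 1)`, for `a` in the alphabet of `b`.
Here `k = A * k.divNat + k.modNat`. -/
noncomputable def leftEndpoint {M A : ℕ} (ω : SampleSpace M A) : (j : ℕ) → Fin (A ^ j) → ℝ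
  | 0, _ => 0
  | j + 1, k =>
    let p : Fin (A ^ j) := Fin.divNat (m := A ^ j) (n := A) k
    let r : Fin A := Fin.modNat (m := A ^ j) (n := A) k
    leftEndpoint ω j p + (((ω j p).digit r : ℕ) : ℝ) / (M : ℝ) ^ (j + 1)

/-- The set `B_j` of left endpoints after `j` iterations. -/
def leftEndpoints {M A : ℕ} (ω : SampleSpace M A) (j : ℕ) : Set ℝ :=
  Set.range (leftEndpoint ω j)

/-- The recursion that defines the sets of left endpoints. -/
theorem leftEndpoints_succ {M A : ℕ} (ω : SampleSpace M A) (j : ℕ) :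
    leftEndpoints ω (j + 1) = ⋃ p : Fin (A ^ j),
      {x | ∃ a ∈ (ω j p).1, x = leftEndpoint ω j p + ((a : ℕ) : ℝ) / (M : ℝ) ^ (j + 1)} := by
  ext x
  simp only [leftEndpoints, Set.mem_range, Set.mem_iUnion, Set.mem_ofPred_eq]
  constructor
  · rintro ⟨k, rfl⟩
    exact ⟨Fin.divNat (m := A ^ j) (n := A) k, _, Finset.orderEmbOfFin_mem _ _ _, rfl⟩
  · rintro ⟨p, a, ha, rfl⟩
    obtain ⟨r, rfl⟩ : a ∈ Set.range ((ω j p).1.orderEmbOfFin (ω j p).2) := by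
      rw [Finset.range_orderEmbOfFin]; exact ha
    have h := finProdFinEquiv.left_inv (p, r)
    have h1 : (finProdFinEquiv (p, r)).divNat = p := congrArg Prod.fst h
    have h2 : (finProdFinEquiv (p, r)).modNat = r := congrArg Prod.snd h
    refine ⟨(finProdFinEquiv (p, r) : Fin (A ^ j * A)), ?_⟩
    simp only [leftEndpoint]
    rw [h1, h2]
    rfl

/-- The first set of left endpoints is `M⁻¹` times the first alphabet. -/
theorem leftEndpoints_one {M A : ℕ} (ω : SampleSpace M A) :
    leftEndpoints ω 1 = {x | ∃ a ∈ (ω 0 0).1, x = ((a : ℕ) : ℝ) / (M : ℝ)} := by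
  rw [leftEndpoints_succ]
  ext x
  have h0 : ∀ p : Fin (A ^ 0), p = 0 := fun p => by
    ext; have := p.2; simp only [pow_zero] at this; simpa using this
  simp only [Set.mem_iUnion, Set.mem_ofPred_eq, leftEndpoint, zero_add, pow_one]
  exact ⟨fun ⟨p, hp⟩ => by rwa [h0 p] at hp, fun h => ⟨0, h⟩⟩

/-- Consecutive left endpoints are at least `M⁻ʲ` apart; in particular the enumeration is
increasing, and there are exactly `A ^ j` left endpoints. -/
theorem leftEndpoint_add_le {M A : ℕ} (ω : SampleSpace M A) (j : ℕ)
    {k k' : Fin (A ^ j)} (h : k < k') :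
    leftEndpoint ω j k + 1 / (M : ℝ) ^ j ≤ leftEndpoint ω j k' := by
  induction j with
  | zero => exact absurd h (by have := k.2; have := k'.2; simp at *; omega)
  | succ j ih =>
    have hk : (k : ℕ) < k' := h
    have hA : 0 < A := by
      rcases Nat.eq_zero_or_pos A with h0 | h0
      · have := k.2; simp [h0] at this
      · exact h0
    set p := Fin.divNat (m := A ^ j) (n := A) k with hp
    set p' := Fin.divNat (m := A ^ j) (n := A) k' with hp'
    set r := Fin.modNat (m := A ^ j) (n := A) k with hr
    set r' := Fin.modNat (m := A ^ j) (n := A) k' with hr'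
    have hM : 0 < M := ((ω j p).digit r).pos
    have hMj : (0 : ℝ) < (M : ℝ) ^ (j + 1) := by positivity
    change leftEndpoint ω j p + (((ω j p).digit r : ℕ) : ℝ) / (M : ℝ) ^ (j + 1) + _
      ≤ leftEndpoint ω j p' + (((ω j p').digit r' : ℕ) : ℝ) / (M : ℝ) ^ (j + 1)
    have hle : p ≤ p' := Nat.div_le_div_right hk.le
    rcases hle.lt_or_eq with hlt | heq
    · have h1 := ih hlt
      have h2 : (((ω j p).digit r : ℕ) : ℝ) + 1 ≤ M := by exact_mod_cast ((ω j p).digit r).2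
      have h3 : (0 : ℝ) ≤ (((ω j p').digit r' : ℕ) : ℝ) / (M : ℝ) ^ (j + 1) := by positivity
      have h4 : (((ω j p).digit r : ℕ) : ℝ) / (M : ℝ) ^ (j + 1) + 1 / (M : ℝ) ^ (j + 1)
          ≤ 1 / (M : ℝ) ^ j := by
        have : 1 / (M : ℝ) ^ j = M / (M : ℝ) ^ (j + 1) := by
          rw [pow_succ]; field_simp
        rw [this, ← add_div]
        gcongr
      linarith
    · have hrr : r < r' := by
        have e : (k : ℕ) / A = k' / A := congrArg Fin.val heq
        change (k : ℕ) % A < k' % A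
        have h1 := Nat.div_add_mod (k : ℕ) A
        have h2 := Nat.div_add_mod (k' : ℕ) A
        rw [e] at h1
        omega
      have h1 : (ω j p).digit r < (ω j p).digit r' := (OrderEmbedding.strictMono _) hrr
      have h2 : (((ω j p).digit r : ℕ) : ℝ) + 1 ≤ (((ω j p).digit r' : ℕ) : ℝ) := by
        exact_mod_cast h1
      rw [← heq, add_assoc, ← add_div]
      gcongr

/-- The `j`-th approximation `C_j` of the Cantor set, a union of `A ^ j` intervals. -/
def cantorApprox {M A : ℕ} (ω : SampleSpace M A) (j : ℕ) : Set ℝ :=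
  ⋃ b ∈ leftEndpoints ω j, Set.Icc b (b + 1 / (M : ℝ) ^ j)

/-- The measure `ν_j` on `ℝ` with density `(M ^ j / A ^ j) 1_{C_j}`. -/
noncomputable def approxMeasure {M A : ℕ} (ω : SampleSpace M A) (j : ℕ) : Measure ℝ :=
  volume.withDensity
    ((cantorApprox ω j).indicator fun _ => ENNReal.ofReal ((M : ℝ) ^ j / (A : ℝ) ^ j))

/-- `ν` is the random Cantor measure of the sample `ω`: the probability measure that is the weak
limit of the measures `ν_j`. (Weak limits are unique.) -/
def IsCantorMeasure {M A : ℕ} (ω : SampleSpace M A) (ν : Measure ℝ) : Prop :=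
  IsProbabilityMeasure ν ∧
    ∀ f : ℝ →ᵇ ℝ, Tendsto (fun j : ℕ => ∫ x, f x ∂(approxMeasure ω j)) atTop (𝓝 (∫ x, f x ∂ν))

/-- The unitarily normalized Fourier transform of a measure,
`(2π)^(-1/2) ∫ exp (-i x ξ) dν(x)`. -/
noncomputable def fourierTransform (ν : Measure ℝ) (ξ : ℝ) : ℂ :=
  ((1 / Real.sqrt (2 * Real.pi) : ℝ) : ℂ) * ∫ x : ℝ, Complex.exp (-Complex.I * x * ξ) ∂ν

end RandomCantor

namespace RandomCantor

open ProbabilityTheory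

/-! ### Sampling without replacement -/

/-! For fixed `ξ` the Fourier transforms of the measures `ν_j` form a martingale in `j`. Its
increment from `j` to `j + 1` is `deviation ω j ξ / A ^ (j + 1)` times the normalized transform of
an interval of length `M⁻⁽ʲ⁺¹⁾` (`integral_wave_approxMeasure_succ`).

Given the first `j` generations, the deviation is a sum of `A ^ j` independent centred terms, each a
sum over a uniform subset of size `A`. Such a subset sum is as sub-Gaussian as `A` independent
samples (`sum_powersetCard_exp_le`), so at one frequency the deviation exceeds `2√(A^(j+1)
M^((j+1)ε))` with probability at most `4 exp(-M^((j+1)ε) / 2)`. The deviation is periodic and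
Lipschitz in `ξ`, so a grid of `M^(2(j+1))` frequencies controls all of them. A union bound over the
grid and over `j` gives `goodSet`, where every normalized deviation is at most `16
M^(-(j+1)(δ-ε)/2)`.

On `goodSet` the increments are summable, so the characteristic functions converge; as all `ν_j`
live on `[0, 1]`, the weak limit exists. The interval factor is at most `min(1, 2 M^J / |ξ|)`, so
the increments form a two-sided geometric series peaking near `M^J ≈ |ξ|`, whose sum is of order
`|ξ|^(-(δ-ε)/2)` (`sum_min_mul_rpow_le`). -/

theorem integral_uniformOn_univ {α : Type*} [Fintype α] [MeasurableSpace α]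
    [MeasurableSingletonClass α] (f : α → ℝ) :
    ∫ x, f x ∂(uniformOn (Set.univ : Set α)) = (Fintype.card α : ℝ)⁻¹ * ∑ x, f x := by
  rw [uniformOn, ProbabilityTheory.cond, Measure.restrict_univ, integral_smul_measure,
    integral_count]
  simp

/-- Hoeffding's lemma for a uniformly chosen element of a finite set. -/
theorem sum_exp_sub_mean_le {α : Type*} {U : Finset α} (hU : U.Nonempty) {c : α → ℝ}
    (hc : ∀ x ∈ U, |c x| ≤ 1) (t : ℝ) :
    ∑ x ∈ U, Real.exp (t * (c x - (∑ y ∈ U, c y) / U.card)) ≤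
      U.card * Real.exp (t ^ 2 / 2) := by
  let _ : MeasurableSpace U := ⊤
  have : Nonempty U := hU.to_subtype
  have hcard : (0 : ℝ) < U.card := by exact_mod_cast hU.card_pos
  have h := (hasSubgaussianMGF_of_mem_Icc (μ := uniformOn (Set.univ : Set U))
    (X := fun x : U => c x) (a := -1) (b := 1) (Measurable.of_discrete.aemeasurable)
    (ae_of_all _ fun x => abs_le.mp (hc x x.2))).mgf_le t
  rw [mgf, integral_uniformOn_univ, integral_uniformOn_univ, Fintype.card_coe,
    Finset.sum_coe_sort U c,
    Finset.sum_coe_sort U fun x => Real.exp (t * (c x - (U.card : ℝ)⁻¹ * ∑ y ∈ U, c y)),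
    inv_mul_le_iff₀ hcard] at h
  have e : (((‖(1 : ℝ) - -1‖₊ / 2) ^ 2 : NNReal) : ℝ) = 1 := by
    push_cast; norm_num
  rw [e, one_mul] at h
  simpa only [div_eq_inv_mul] using h

/-- Double counting of the pairs `x ∈ S`. It amounts to drawing one element `x` first and the other
`k` from the rest, which drives the induction on the sample size. -/
theorem sum_powersetCard_succ {α : Type*} [DecidableEq α] (U : Finset α) (k : ℕ)
    (F : Finset α → ℝ) :
    ((k : ℝ) + 1) * ∑ S ∈ U.powersetCard (k + 1), F S =
      ∑ x ∈ U, ∑ S ∈ (U.erase x).powersetCard k, F (insert x S) := by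
  have h1 : ((k : ℝ) + 1) * ∑ S ∈ U.powersetCard (k + 1), F S =
      ∑ S ∈ U.powersetCard (k + 1), ∑ _x ∈ S, F S := by
    rw [Finset.mul_sum]
    refine Finset.sum_congr rfl fun S hS => ?_
    simp [(Finset.mem_powersetCard.mp hS).2]
  rw [h1, Finset.sum_sigma', Finset.sum_sigma']
  refine Finset.sum_bij' (fun p _ => ⟨p.2, p.1.erase p.2⟩) (fun p _ => ⟨insert p.1 p.2, p.1⟩)
    ?_ ?_ ?_ ?_ ?_
  · rintro ⟨S, x⟩ h
    simp only [Finset.mem_sigma, Finset.mem_powersetCard] at h ⊢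
    exact ⟨h.1.1 h.2, Finset.erase_subset_erase _ h.1.1, by
      rw [Finset.card_erase_of_mem h.2, h.1.2]; rfl⟩
  · rintro ⟨x, S⟩ h
    simp only [Finset.mem_sigma, Finset.mem_powersetCard] at h ⊢
    have hx : x ∉ S := fun hx => Finset.notMem_erase _ _ (h.2.1 hx)
    refine ⟨⟨Finset.insert_subset h.1 (h.2.1.trans (Finset.erase_subset _ _)), ?_⟩,
      Finset.mem_insert_self _ _⟩
    rw [Finset.card_insert_of_notMem hx, h.2.2]
  · rintro ⟨S, x⟩ h
    simp only [Finset.mem_sigma] at h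
    simp [Finset.insert_erase h.2]
  · rintro ⟨x, S⟩ h
    simp only [Finset.mem_sigma, Finset.mem_powersetCard] at h
    have hx : x ∉ S := fun hx => Finset.notMem_erase _ _ (h.2.1 hx)
    simp [Finset.erase_insert hx]
  · rintro ⟨S, x⟩ h
    simp only [Finset.mem_sigma] at h
    simp [Finset.insert_erase h.2]

/-- The sum of a bounded function over a uniformly chosen subset of cardinality `k` satisfies the
same sub-Gaussian bound as the sum of `k` independent samples. -/
theorem sum_powersetCard_exp_le {α : Type*} [DecidableEq α] (k : ℕ) :
    ∀ (U : Finset α), k ≤ U.card → ∀ (c : α → ℝ), (∀ x ∈ U, |c x| ≤ 1) → ∀ t : ℝ,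
      ∑ S ∈ U.powersetCard k, Real.exp (t * (∑ x ∈ S, c x - k * ((∑ x ∈ U, c x) / U.card))) ≤
        U.card.choose k * Real.exp (k * (t ^ 2 / 2)) := by
  induction k with
  | zero => intro U _ c _ t; simp
  | succ k ih =>
    intro U hkU c hc t
    have hU : U.Nonempty := Finset.card_pos.mp (by omega)
    obtain ⟨m, hm⟩ : ∃ m, U.card = m + 1 := ⟨U.card - 1, by omega⟩
    have hkm : k ≤ m := by omega
    set u := (∑ x ∈ U, c x) / U.card with hu
    have hsum : ∑ x ∈ U, c x = (m + 1) * u := by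
      rw [hu, hm]; push_cast; field_simp
    -- Removing `x` shifts the mean of the remaining `m` points by `-(c x - u) / m`, hence the
    -- expected sum of the `k` later draws by `-(k / m) (c x - u)`. The net influence of the first
    -- draw is thus `θ (c x - u)` with `0 ≤ θ ≤ 1`, no more than that of an independent sample.
    set θ : ℝ := 1 - k / m with hθ
    have hθ0 : 0 ≤ θ := sub_nonneg.mpr (div_le_one_of_le₀ (by exact_mod_cast hkm) (by positivity))
    have hθ1 : θ ≤ 1 := sub_le_self _ (by positivity)
    have hk1 : (0 : ℝ) < (k : ℝ) + 1 := by positivity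
    have step : ∀ x ∈ U, ∑ S ∈ (U.erase x).powersetCard k,
        Real.exp (t * (∑ y ∈ insert x S, c y - ((k + 1 : ℕ) : ℝ) * u)) ≤
        Real.exp (t * θ * (c x - u)) * (m.choose k * Real.exp (k * (t ^ 2 / 2))) := by
      intro x hx
      have hcard : (U.erase x).card = m := by rw [Finset.card_erase_of_mem hx, hm]; rfl
      have h := ih (U.erase x) (by omega) c (fun y hy => hc y (Finset.mem_of_mem_erase hy)) t
      rw [hcard] at h
      refine le_trans (le_of_eq ?_) (mul_le_mul_of_nonneg_left h (Real.exp_nonneg _))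
      rw [Finset.mul_sum]
      refine Finset.sum_congr rfl fun S hS => ?_
      have hxS : x ∉ S := fun h =>
        Finset.notMem_erase _ _ ((Finset.mem_powersetCard.mp hS).1 h)
      have he : ∑ y ∈ U.erase x, c y = (m + 1) * u - c x := by
        rw [← hsum, ← Finset.add_sum_erase U c hx]; ring
      rw [Finset.sum_insert hxS, ← Real.exp_add, he, hθ]
      congr 1
      -- For `m = 0` the convention `k / 0 = 0` gives `θ = 1`, as it should for a single draw.
      rcases Nat.eq_zero_or_pos m with h0 | h0
      · have : k = 0 := by omega
        subst this; subst h0; simp; ring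
      · have : (m : ℝ) ≠ 0 := by positivity
        push_cast
        field_simp
        ring
    have hmain : ((k : ℝ) + 1) * ∑ S ∈ U.powersetCard (k + 1),
        Real.exp (t * (∑ x ∈ S, c x - ((k + 1 : ℕ) : ℝ) * u)) ≤
        ((k : ℝ) + 1) * (U.card.choose (k + 1) *
          Real.exp (((k + 1 : ℕ) : ℝ) * (t ^ 2 / 2))) := by
      rw [sum_powersetCard_succ]
      refine (Finset.sum_le_sum step).trans ?_
      rw [← Finset.sum_mul]
      have h1 := sum_exp_sub_mean_le hU hc (t * θ)
      rw [← hu] at h1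
      have h2 : Real.exp ((t * θ) ^ 2 / 2) ≤ Real.exp (t ^ 2 / 2) := by
        apply Real.exp_le_exp.mpr
        have : θ ^ 2 ≤ 1 := pow_le_one₀ hθ0 hθ1
        nlinarith [sq_nonneg t]
      have h3 : ((k : ℝ) + 1) * ((m + 1).choose (k + 1) : ℝ) = (m + 1) * m.choose k := by
        have := Nat.add_one_mul_choose_eq m k
        have h4 : ((m : ℝ) + 1) * m.choose k = (m + 1).choose (k + 1) * (k + 1) := by
          exact_mod_cast this
        rw [h4]; ring
      calc _ ≤ (U.card * Real.exp (t ^ 2 / 2)) * (m.choose k * Real.exp (k * (t ^ 2 / 2))) := by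
            gcongr
            exact h1.trans (mul_le_mul_of_nonneg_left h2 (Nat.cast_nonneg _))
        _ = _ := by
            rw [hm, ← mul_assoc ((k : ℝ) + 1), h3]
            have h5 : Real.exp (((k + 1 : ℕ) : ℝ) * (t ^ 2 / 2)) =
                Real.exp (k * (t ^ 2 / 2)) * Real.exp (t ^ 2 / 2) := by
              rw [← Real.exp_add]; push_cast; ring_nf
            rw [h5]
            push_cast
            ring
    exact le_of_mul_le_mul_left hmain hk1

theorem card_alphabet (M A : ℕ) : Fintype.card (Alphabet M A) = M.choose A := by
  have h := Fintype.card_finset_len (α := Fin M) A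
  rw [Fintype.card_fin] at h
  rw [← h]
  exact Fintype.card_congr (Equiv.refl _)

theorem hasSubgaussianMGF_alphabet {M A : ℕ} (hAM : A ≤ M) {c : Fin M → ℝ}
    (hc : ∀ a, |c a| ≤ 1) :
    HasSubgaussianMGF (fun s : Alphabet M A => ∑ a ∈ s.1, c a - A * ((∑ a, c a) / M))
      A (alphabetMeasure M A) := by
  have := Alphabet.nonempty hAM
  refine ⟨fun t => ?_, fun t => ?_⟩
  · exact Integrable.of_finite
  · have hch : (0 : ℝ) < M.choose A := by exact_mod_cast Nat.choose_pos hAM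
    rw [mgf, alphabetMeasure, integral_uniformOn_univ, card_alphabet, inv_mul_le_iff₀ hch]
    have h := sum_powersetCard_exp_le A (Finset.univ : Finset (Fin M)) (by simpa using hAM) c
      (fun x _ => hc x) t
    rw [Finset.card_univ, Fintype.card_fin] at h
    refine le_trans (le_of_eq ?_) (h.trans (le_of_eq ?_))
    · symm
      refine Finset.sum_subtype _ (p := fun s : Finset (Fin M) => s.card = A) ?_ _
      simp [Finset.mem_powersetCard]
    · push_cast; rw [mul_div_assoc]

end RandomCantor

namespace RandomCantor

open ProbabilityTheory

/-! ### The conditional deviation of an exponential sum -/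

/-- Resampling one coordinate preserves a product of probability measures. -/
theorem map_update_infinitePi {ι : Type*} [DecidableEq ι] {X : ι → Type*}
    [∀ i, MeasurableSpace (X i)] (μ : (i : ι) → Measure (X i)) [∀ i, IsProbabilityMeasure (μ i)]
    (i : ι) :
    ((Measure.infinitePi μ).prod (μ i)).map (fun p => Function.update p.1 i p.2) =
      Measure.infinitePi μ := by
  refine Measure.eq_infinitePi μ fun s t ht => ?_
  rw [Measure.map_apply measurable_update' (MeasurableSet.pi s.countable_toSet fun i _ => ht i)]
  by_cases hi : i ∈ s
  · have : (fun p : ((i : ι) → X i) × X i => Function.update p.1 i p.2) ⁻¹' Set.pi s t =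
        Set.pi (s.erase i : Finset ι) t ×ˢ t i := by
      ext ⟨ω, x⟩
      simp only [Set.mem_preimage, Set.mem_pi, Finset.mem_coe, Set.mem_prod, Finset.mem_erase]
      constructor
      · intro h
        refine ⟨fun k hk => ?_, ?_⟩
        · simpa [Function.update_of_ne hk.1] using h k hk.2
        · simpa using h i hi
      · rintro ⟨h1, h2⟩ k hk
        by_cases hki : k = i
        · subst hki; simpa using h2
        · simpa [Function.update_of_ne hki] using h1 k ⟨hki, hk⟩
    rw [this, Measure.prod_prod, Measure.infinitePi_pi _ fun i _ => ht i,
      Finset.prod_erase_mul _ _ hi]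
  · have : (fun p : ((i : ι) → X i) × X i => Function.update p.1 i p.2) ⁻¹' Set.pi s t =
        Set.pi s t ×ˢ Set.univ := by
      ext ⟨ω, x⟩
      simp only [Set.mem_preimage, Set.mem_pi, Finset.mem_coe, Set.mem_prod, Set.mem_univ,
        and_true]
      refine forall₂_congr fun k hk => ?_
      have hki : k ≠ i := by rintro rfl; exact hi hk
      rw [Function.update_of_ne hki]
    rw [this, Measure.prod_prod, Measure.infinitePi_pi _ fun i _ => ht i, measure_univ, mul_one]

/-- This replaces conditioning: a bound uniform over all frozen values of the other coordinates
integrates to a bound for the whole product. -/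
theorem infinitePi_le_of_update {ι : Type*} [DecidableEq ι] {X : ι → Type*}
    [∀ i, MeasurableSpace (X i)] (μ : (i : ι) → Measure (X i)) [∀ i, IsProbabilityMeasure (μ i)]
    (i : ι) {S : Set ((i : ι) → X i)} (hS : MeasurableSet S) {r : ENNReal}
    (h : ∀ ω, μ i {x | Function.update ω i x ∈ S} ≤ r) : Measure.infinitePi μ S ≤ r := by
  rw [← map_update_infinitePi μ i, Measure.map_apply measurable_update' hS,
    Measure.prod_apply (measurable_update' hS)]
  calc _ ≤ ∫⁻ _, r ∂(Measure.infinitePi μ) := lintegral_mono fun ω => h ω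
    _ = r := by simp

/-- The character `x ↦ exp (-i x ξ)`. -/
noncomputable def wave (ξ x : ℝ) : ℂ := Complex.exp (-Complex.I * x * ξ)

theorem norm_wave (ξ x : ℝ) : ‖wave ξ x‖ = 1 := by
  rw [wave, show -Complex.I * x * ξ = ((-(x * ξ) : ℝ) : ℂ) * Complex.I by push_cast; ring]
  exact Complex.norm_exp_ofReal_mul_I _

theorem wave_add (ξ x y : ℝ) : wave ξ (x + y) = wave ξ x * wave ξ y := by
  rw [wave, wave, wave, ← Complex.exp_add]; push_cast; ring_nf

theorem continuous_wave (ξ : ℝ) : Continuous (wave ξ) := by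
  unfold wave; fun_prop

variable {M A : ℕ}

/-- The point of the grid `M⁻⁽ʲ⁺¹⁾ ℤ` given by the digit `a` in the `p`-th interval. -/
noncomputable def child (ω : SampleSpace M A) (j : ℕ) (p : Fin (A ^ j)) (a : Fin M) : ℝ :=
  leftEndpoint ω j p + ((a : ℕ) : ℝ) / (M : ℝ) ^ (j + 1)

/-- The exponential sum over the left endpoints of generation `j + 1`, minus its conditional
expectation given the first `j` generations. -/
noncomputable def deviation (ω : SampleSpace M A) (j : ℕ) (ξ : ℝ) : ℂ :=
  ∑ p, (∑ a ∈ (ω j p).1, wave ξ (child ω j p a) -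
    A * ((∑ a, wave ξ (child ω j p a)) / M))

theorem measurable_leftEndpoint (j : ℕ) (k : Fin (A ^ j)) :
    Measurable fun ω : SampleSpace M A => leftEndpoint ω j k := by
  induction j with
  | zero => exact measurable_const
  | succ j ih =>
    have h : Measurable fun ω : SampleSpace M A =>
        ((((ω j (Fin.divNat (m := A ^ j) (n := A) k)).digit
          (Fin.modNat (m := A ^ j) (n := A) k) : Fin M) : ℕ) : ℝ) :=
      (Measurable.of_discrete (f := fun s : Alphabet M A =>
        (((s.digit (Fin.modNat (m := A ^ j) (n := A) k) : Fin M) : ℕ) : ℝ))).comp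
        ((measurable_pi_apply _).comp (measurable_pi_apply j))
    exact (ih _).add (h.div_const _)

theorem measurable_deviation (j : ℕ) (ξ : ℝ) :
    Measurable fun ω : SampleSpace M A => deviation ω j ξ := by
  have h1 : ∀ (p : Fin (A ^ j)) (a : Fin M),
      Measurable fun ω : SampleSpace M A => wave ξ (child ω j p a) := fun p a =>
    (continuous_wave ξ).measurable.comp ((measurable_leftEndpoint j p).add_const _)
  have h2 : ∀ p : Fin (A ^ j), Measurable fun ω : SampleSpace M A =>
      ∑ a ∈ (ω j p).1, wave ξ (child ω j p a) := by
    intro p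
    have e : (fun ω : SampleSpace M A => ∑ a ∈ (ω j p).1, wave ξ (child ω j p a)) =
        fun ω => ∑ a, (if a ∈ (ω j p).1 then (1 : ℂ) else 0) * wave ξ (child ω j p a) := by
      ext ω; simp
    rw [e]
    refine Finset.measurable_fun_sum _ fun a _ => Measurable.mul ?_ (h1 p a)
    exact (Measurable.of_discrete (f := fun s : Alphabet M A =>
      if a ∈ s.1 then (1 : ℂ) else 0)).comp
        ((measurable_pi_apply _).comp (measurable_pi_apply j))
  refine Finset.measurable_fun_sum _ fun p _ => (h2 p).sub ?_
  exact ((Finset.measurable_fun_sum _ fun a _ => h1 p a).div_const _).const_mul _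

/-- Generation `j` depends only on the alphabets of earlier generations, so resampling `ω j` leaves
the points `child ω j p a` fixed. -/
theorem leftEndpoint_congr {ω ω' : SampleSpace M A} {j : ℕ} (h : ∀ i < j, ω i = ω' i) :
    leftEndpoint ω j = leftEndpoint ω' j := by
  induction j with
  | zero => rfl
  | succ j ih =>
    ext k
    simp only [leftEndpoint]
    rw [ih fun i hi => h i (by omega), h j (by omega)]

theorem child_update (ω : SampleSpace M A) (j : ℕ) (x : Fin (A ^ j) → Alphabet M A) :
    child (Function.update ω j x) j = child ω j := by
  ext p a
  rw [child, child, leftEndpoint_congr (ω' := ω)]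
  intro i hi
  exact Function.update_of_ne hi.ne _ _

/-- A Chernoff bound: `A ^ j` independent terms with variance proxy `A` each have total proxy `A ^
(j + 1)`. -/
theorem pi_alphabetMeasure_tail (hAM : A ≤ M) {j : ℕ} {c : Fin (A ^ j) → Fin M → ℝ}
    (hc : ∀ p a, |c p a| ≤ 1) {T : ℝ} (hT : 0 ≤ T) :
    (Measure.pi fun _ : Fin (A ^ j) => alphabetMeasure M A)
      {x | T ≤ ∑ p, (∑ a ∈ (x p).1, c p a - A * ((∑ a, c p a) / M))} ≤
        ENNReal.ofReal (Real.exp (-(T ^ 2 / (2 * (A : ℝ) ^ (j + 1))))) := by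
  have := Alphabet.nonempty hAM
  have hind : iIndepFun (fun (p : Fin (A ^ j)) (x : Fin (A ^ j) → Alphabet M A) =>
      ∑ a ∈ (x p).1, c p a - A * ((∑ a, c p a) / M))
      (Measure.pi fun _ : Fin (A ^ j) => alphabetMeasure M A) :=
    iIndepFun_pi (X := fun p (s : Alphabet M A) =>
      ∑ a ∈ s.1, c p a - A * ((∑ a, c p a) / M)) fun p => Measurable.of_discrete.aemeasurable
  have hsub : ∀ p ∈ (Finset.univ : Finset (Fin (A ^ j))),
      HasSubgaussianMGF (fun x : Fin (A ^ j) → Alphabet M A =>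
        ∑ a ∈ (x p).1, c p a - A * ((∑ a, c p a) / M)) A
        (Measure.pi fun _ : Fin (A ^ j) => alphabetMeasure M A) := by
    intro p _
    have hp := measurePreserving_eval (fun _ : Fin (A ^ j) => alphabetMeasure M A) p
    refine HasSubgaussianMGF.of_map (X := fun s : Alphabet M A =>
      ∑ a ∈ s.1, c p a - A * ((∑ a, c p a) / M)) (Y := Function.eval p)
      hp.measurable.aemeasurable ?_
    rw [hp.map_eq]
    exact hasSubgaussianMGF_alphabet hAM (hc p)
  have h := HasSubgaussianMGF.measure_sum_ge_le_of_iIndepFun hind hsub hT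
  rw [← ofReal_measureReal]
  refine ENNReal.ofReal_le_ofReal (h.trans (le_of_eq ?_))
  congr 1
  simp only [Finset.sum_const, Finset.card_univ, Fintype.card_fin, nsmul_eq_mul]
  push_cast
  rw [pow_succ]
  ring

theorem re_deviation_update (ω : SampleSpace M A) (j : ℕ) (ξ : ℝ) (u : ℂ)
    (x : Fin (A ^ j) → Alphabet M A) :
    (u * deviation (Function.update ω j x) j ξ).re =
      ∑ p, (∑ a ∈ (x p).1, (u * wave ξ (child ω j p a)).re -
        A * ((∑ a, (u * wave ξ (child ω j p a)).re) / M)) := by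
  rw [deviation, child_update, Function.update_self, Finset.mul_sum, Complex.re_sum]
  refine Finset.sum_congr rfl fun p _ => ?_
  have e : u * (∑ a ∈ (x p).1, wave ξ (child ω j p a) -
      A * ((∑ a, wave ξ (child ω j p a)) / M)) =
      ∑ a ∈ (x p).1, u * wave ξ (child ω j p a) -
        ((A / M : ℝ) : ℂ) * ∑ a, u * wave ξ (child ω j p a) := by
    rw [← Finset.mul_sum, ← Finset.mul_sum]; push_cast; ring
  rw [e, Complex.sub_re, Complex.re_ofReal_mul, Complex.re_sum, Complex.re_sum]
  ring

theorem sampleMeasure_re_deviation_tail (hAM : A ≤ M) (j : ℕ) (ξ : ℝ) {u : ℂ} (hu : ‖u‖ = 1)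
    {T : ℝ} (hT : 0 ≤ T) :
    sampleMeasure M A {ω | T ≤ (u * deviation ω j ξ).re} ≤
      ENNReal.ofReal (Real.exp (-(T ^ 2 / (2 * (A : ℝ) ^ (j + 1))))) := by
  have := Alphabet.nonempty hAM
  refine infinitePi_le_of_update _ j ?_ fun ω => ?_
  · exact measurableSet_le measurable_const
      (Complex.measurable_re.comp ((measurable_deviation j ξ).const_mul u))
  · simp only [Set.mem_ofPred_eq, re_deviation_update]
    refine pi_alphabetMeasure_tail hAM (fun p a => ?_) hT
    refine (Complex.abs_re_le_norm _).trans ?_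
    rw [norm_mul, hu, norm_wave, one_mul]

theorem sampleMeasure_deviation_tail (hAM : A ≤ M) (j : ℕ) (ξ : ℝ) {T : ℝ} (hT : 0 ≤ T) :
    sampleMeasure M A {ω | 2 * T ≤ ‖deviation ω j ξ‖} ≤
      ENNReal.ofReal (4 * Real.exp (-(T ^ 2 / (2 * (A : ℝ) ^ (j + 1))))) := by
  -- If `|z| ≥ 2T`, the real or the imaginary part of `z` has absolute value at least `T`. The four
  -- rotations `±1`, `±I` turn this into one-sided bounds.
  have hsub : {ω : SampleSpace M A | 2 * T ≤ ‖deviation ω j ξ‖} ⊆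
      ({ω | T ≤ (1 * deviation ω j ξ).re} ∪ {ω | T ≤ (-1 * deviation ω j ξ).re}) ∪
      ({ω | T ≤ (Complex.I * deviation ω j ξ).re} ∪
        {ω | T ≤ (-Complex.I * deviation ω j ξ).re}) := by
    intro ω hω
    simp only [Set.mem_union, Set.mem_ofPred_eq] at hω ⊢
    by_contra! h
    obtain ⟨⟨h1, h2⟩, h3, h4⟩ := h
    simp at h1 h2 h3 h4
    have := Complex.norm_le_abs_re_add_abs_im (deviation ω j ξ)
    have h5 : |(deviation ω j ξ).re| < T := abs_lt.mpr ⟨by linarith, h1⟩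
    have h6 : |(deviation ω j ξ).im| < T := abs_lt.mpr ⟨by linarith, h4⟩
    linarith
  refine (measure_mono hsub).trans ((measure_union_le _ _).trans
    ((add_le_add (measure_union_le _ _) (measure_union_le _ _)).trans ?_))
  refine (add_le_add
    (add_le_add (sampleMeasure_re_deviation_tail hAM j ξ (by simp) hT)
      (sampleMeasure_re_deviation_tail hAM j ξ (by simp) hT))
    (add_le_add (sampleMeasure_re_deviation_tail hAM j ξ (by simp) hT)
      (sampleMeasure_re_deviation_tail hAM j ξ (by simp) hT))).trans (le_of_eq ?_)
  rw [← ENNReal.ofReal_add (by positivity) (by positivity),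
    ← ENNReal.ofReal_add (by positivity) (by positivity)]
  ring_nf

end RandomCantor

namespace RandomCantor

variable {M A : ℕ}

/-! ### Uniform bounds for the deviations -/

theorem leftEndpoint_mem_Icc (hM : 0 < M) (ω : SampleSpace M A) (j : ℕ) (k : Fin (A ^ j)) :
    leftEndpoint ω j k ∈ Set.Icc 0 (1 - 1 / (M : ℝ) ^ j) := by
  induction j with
  | zero => simp [leftEndpoint]
  | succ j ih =>
    have h := ih (Fin.divNat (m := A ^ j) (n := A) k)
    set d := (ω j (Fin.divNat (m := A ^ j) (n := A) k)).digit
      (Fin.modNat (m := A ^ j) (n := A) k) with hd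
    have h2 : ((d : ℕ) : ℝ) + 1 ≤ M := by exact_mod_cast d.2
    have hMr : (0 : ℝ) < M := by exact_mod_cast hM
    have h4 : ((d : ℕ) : ℝ) / (M : ℝ) ^ (j + 1) + 1 / (M : ℝ) ^ (j + 1) ≤ 1 / (M : ℝ) ^ j := by
      have : 1 / (M : ℝ) ^ j = M / (M : ℝ) ^ (j + 1) := by
        rw [pow_succ]; field_simp
      rw [this, ← add_div]
      gcongr
    have h3 : (0 : ℝ) ≤ ((d : ℕ) : ℝ) / (M : ℝ) ^ (j + 1) := by positivity
    simp only [leftEndpoint, Set.mem_Icc] at h ⊢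
    rw [← hd]
    constructor <;> linarith [h.1, h.2]

theorem child_mem_Icc (hM : 0 < M) (ω : SampleSpace M A) (j : ℕ) (p : Fin (A ^ j)) (a : Fin M) :
    child ω j p a ∈ Set.Icc (0 : ℝ) 1 := by
  have h := leftEndpoint_mem_Icc hM ω j p
  have hMr : (0 : ℝ) < M := by exact_mod_cast hM
  have h4 : ((a : ℕ) : ℝ) / (M : ℝ) ^ (j + 1) ≤ 1 / (M : ℝ) ^ j := by
    have : 1 / (M : ℝ) ^ j = M / (M : ℝ) ^ (j + 1) := by
      rw [pow_succ]; field_simp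
    rw [this]
    gcongr
    exact a.2.le
  have h3 : (0 : ℝ) ≤ ((a : ℕ) : ℝ) / (M : ℝ) ^ (j + 1) := by positivity
  simp only [child, Set.mem_Icc] at h ⊢
  constructor <;> linarith [h.1, h.2]

theorem exists_leftEndpoint_eq_div (hM : 0 < M) (ω : SampleSpace M A) (j : ℕ) (k : Fin (A ^ j)) :
    ∃ n : ℕ, leftEndpoint ω j k = n / (M : ℝ) ^ j := by
  induction j with
  | zero => exact ⟨0, by simp [leftEndpoint]⟩
  | succ j ih =>
    obtain ⟨n, hn⟩ := ih (Fin.divNat (m := A ^ j) (n := A) k)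
    have hMr : (0 : ℝ) < M := by exact_mod_cast hM
    refine ⟨n * M + (ω j (Fin.divNat (m := A ^ j) (n := A) k)).digit
      (Fin.modNat (m := A ^ j) (n := A) k), ?_⟩
    simp only [leftEndpoint]
    rw [hn]
    push_cast
    rw [add_div, pow_succ, mul_div_mul_right _ _ hMr.ne']

theorem exists_child_eq_div (hM : 0 < M) (ω : SampleSpace M A) (j : ℕ) (p : Fin (A ^ j))
    (a : Fin M) : ∃ n : ℕ, child ω j p a = n / (M : ℝ) ^ (j + 1) := by
  obtain ⟨n, hn⟩ := exists_leftEndpoint_eq_div hM ω j p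
  have hMr : (0 : ℝ) < M := by exact_mod_cast hM
  refine ⟨n * M + a, ?_⟩
  rw [child, hn]
  push_cast
  rw [add_div, pow_succ, mul_div_mul_right _ _ hMr.ne']

/-- All the points involved lie on the grid `M⁻⁽ʲ⁺¹⁾ ℤ`. -/
theorem periodic_deviation (hM : 0 < M) (ω : SampleSpace M A) (j : ℕ) :
    Function.Periodic (deviation ω j) (2 * Real.pi * (M : ℝ) ^ (j + 1)) := by
  have hMr : (0 : ℝ) < M := by exact_mod_cast hM
  intro ξ
  have h : ∀ p a, wave (ξ + 2 * Real.pi * (M : ℝ) ^ (j + 1)) (child ω j p a) =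
      wave ξ (child ω j p a) := by
    intro p a
    obtain ⟨n, hn⟩ := exists_child_eq_div hM ω j p a
    rw [wave, wave, Complex.exp_eq_exp_iff_exists_int]
    refine ⟨-n, ?_⟩
    have hMc : (M : ℂ) ≠ 0 := by exact_mod_cast hM.ne'
    rw [hn]
    push_cast
    field_simp
    ring
  simp only [deviation, h]

theorem norm_wave_sub_wave_le (ξ ξ' x : ℝ) : ‖wave ξ x - wave ξ' x‖ ≤ |x| * |ξ - ξ'| := by
  have h1 : wave ξ x - wave ξ' x = wave ξ' x *
      (Complex.exp (Complex.I * ((-(x * (ξ - ξ')) : ℝ) : ℂ)) - 1) := by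
    rw [mul_sub, mul_one, wave, wave, ← Complex.exp_add]
    push_cast
    ring_nf
  rw [h1, norm_mul, norm_wave, one_mul]
  refine (Real.norm_exp_I_mul_ofReal_sub_one_le).trans ?_
  rw [Real.norm_eq_abs, abs_neg, abs_mul]

/-- Points in `[0, 1]` give 1-Lipschitz waves. The chosen points and the subtracted averages each
carry total weight `A ^ (j + 1)`. -/
theorem norm_deviation_sub_le (hM : 0 < M) (ω : SampleSpace M A) (j : ℕ) (ξ ξ' : ℝ) :
    ‖deviation ω j ξ - deviation ω j ξ'‖ ≤ 2 * (A : ℝ) ^ (j + 1) * |ξ - ξ'| := by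
  have hMr : (0 : ℝ) < M := by exact_mod_cast hM
  have hw : ∀ p a, ‖wave ξ (child ω j p a) - wave ξ' (child ω j p a)‖ ≤ |ξ - ξ'| := by
    intro p a
    refine (norm_wave_sub_wave_le _ _ _).trans ?_
    have h := child_mem_Icc hM ω j p a
    rw [abs_of_nonneg h.1]
    exact mul_le_of_le_one_left (abs_nonneg _) h.2
  have hp : ∀ p, ‖(∑ a ∈ (ω j p).1, wave ξ (child ω j p a) -
      A * ((∑ a, wave ξ (child ω j p a)) / M)) - (∑ a ∈ (ω j p).1, wave ξ' (child ω j p a) -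
      A * ((∑ a, wave ξ' (child ω j p a)) / M))‖ ≤ 2 * A * |ξ - ξ'| := by
    intro p
    have e : (∑ a ∈ (ω j p).1, wave ξ (child ω j p a) -
      A * ((∑ a, wave ξ (child ω j p a)) / M)) - (∑ a ∈ (ω j p).1, wave ξ' (child ω j p a) -
      A * ((∑ a, wave ξ' (child ω j p a)) / M)) =
      ∑ a ∈ (ω j p).1, (wave ξ (child ω j p a) - wave ξ' (child ω j p a)) -
      ((A / M : ℝ) : ℂ) * ∑ a, (wave ξ (child ω j p a) - wave ξ' (child ω j p a)) := by
      rw [Finset.sum_sub_distrib, Finset.sum_sub_distrib]; push_cast; ring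
    rw [e]
    refine (norm_sub_le _ _).trans ?_
    rw [norm_mul, Complex.norm_real, Real.norm_of_nonneg (by positivity)]
    have h1 := norm_sum_le_of_le (ω j p).1 fun a _ => hw p a
    have h2 := norm_sum_le_of_le (Finset.univ : Finset (Fin M)) fun a _ => hw p a
    rw [Finset.sum_const, (ω j p).2, nsmul_eq_mul] at h1
    rw [Finset.sum_const, Finset.card_univ, Fintype.card_fin, nsmul_eq_mul] at h2
    calc _ ≤ A * |ξ - ξ'| + A / M * (M * |ξ - ξ'|) := by gcongr
      _ = _ := by field_simp; ring
  rw [deviation, deviation, ← Finset.sum_sub_distrib]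
  refine (norm_sum_le_of_le _ fun p _ => hp p).trans (le_of_eq ?_)
  rw [Finset.sum_const, Finset.card_univ, Fintype.card_fin, nsmul_eq_mul, pow_succ]
  push_cast
  ring

/-- The deviation at an arbitrary frequency is controlled by its values on a finite grid. -/
theorem exists_norm_deviation_le (hM : 0 < M) (ω : SampleSpace M A) (j : ℕ) (ξ : ℝ) :
    ∃ m < (M ^ (j + 1)) ^ 2, ‖deviation ω j ξ‖ ≤
      ‖deviation ω j (2 * Real.pi / (M : ℝ) ^ (j + 1) * m)‖ +
        2 * (A : ℝ) ^ (j + 1) * (2 * Real.pi / (M : ℝ) ^ (j + 1)) := by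
  have hMr : (0 : ℝ) < M := by exact_mod_cast hM
  -- The `N` grid points of spacing `h` cover exactly one period, `N h = 2π M^(j+1)`.
  set N : ℕ := (M ^ (j + 1)) ^ 2 with hN
  have hN0 : 0 < N := by positivity
  set h : ℝ := 2 * Real.pi / (M : ℝ) ^ (j + 1) with hh
  have hpos : 0 < h := by have := Real.pi_pos; positivity
  set n : ℤ := ⌊ξ / h⌋ with hn
  have hm0 : 0 ≤ n % N := Int.emod_nonneg _ (by exact_mod_cast hN0.ne')
  have hm1 : n % N < N := Int.emod_lt_of_pos _ (by exact_mod_cast hN0)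
  refine ⟨(n % N).toNat, by omega, ?_⟩
  have hcast : (((n % N).toNat : ℕ) : ℝ) = ((n % N : ℤ) : ℝ) := by
    rw [← Int.cast_natCast, Int.toNat_of_nonneg hm0]
  have hper : deviation ω j (h * ((n % N).toNat : ℕ)) = deviation ω j (h * n) := by
    have hnn : (n : ℝ) = ((n % N : ℤ) : ℝ) + (N : ℝ) * ((n / N : ℤ) : ℝ) := by
      have := Int.emod_add_mul_ediv n N
      exact_mod_cast this.symm
    have e : h * n = h * ((n % N : ℤ) : ℝ) +
        ((n / N : ℤ) : ℝ) * (2 * Real.pi * (M : ℝ) ^ (j + 1)) := by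
      rw [hnn, hh, hN]
      push_cast
      field_simp
    rw [hcast, e]
    exact (((periodic_deviation hM ω j).int_mul (n / N : ℤ)) _).symm
  have hle : |ξ - h * n| ≤ h := by
    have h1 := Int.floor_le (ξ / h)
    have h2 := (Int.lt_floor_add_one (ξ / h)).le
    rw [← hn] at h1 h2
    rw [le_div_iff₀ hpos] at h1
    rw [div_le_iff₀ hpos] at h2
    rw [abs_le]
    constructor <;> nlinarith
  rw [hper]
  have h3 := norm_deviation_sub_le hM ω j ξ (h * n)
  have h4 := norm_le_norm_add_norm_sub (deviation ω j (h * n)) (deviation ω j ξ)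
  have h5 : 2 * (A : ℝ) ^ (j + 1) * |ξ - h * n| ≤ 2 * (A : ℝ) ^ (j + 1) * h := by gcongr
  rw [norm_sub_rev] at h4
  rw [norm_sub_rev] at h3
  linarith [norm_sub_rev (deviation ω j (h * n)) (deviation ω j ξ)]

/-- The samples for which the deviations of all generations are small. -/
def goodSet (M A : ℕ) (ε : ℝ) : Set (SampleSpace M A) :=
  ⋂ j : ℕ, ⋂ m ∈ Finset.range ((M ^ (j + 1)) ^ 2),
    {ω | 2 * √((A : ℝ) ^ (j + 1) * ((M : ℝ) ^ (j + 1)) ^ ε) ≤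
      ‖deviation ω j (2 * Real.pi / (M : ℝ) ^ (j + 1) * m)‖}ᶜ

theorem measurableSet_goodSet (M A : ℕ) (ε : ℝ) : MeasurableSet (goodSet M A ε) := by
  refine MeasurableSet.iInter fun j => Finset.measurableSet_biInter _ fun m _ => ?_
  exact (measurableSet_le measurable_const (measurable_deviation j _).norm).compl

/-- With `x = M^(j+1)` and `y = M`, the factor `x ^ 2` counts grid frequencies. Half of the
exponential, through one term of its series, absorbs `x ^ 3`. The spare `1 / x` makes the bounds
summable over `j`; the other half supplies the probability bound. -/
theorem sq_mul_exp_le {ε x y : ℝ} (hε : 0 < ε) (hy : 1 ≤ y) (hxy : y ≤ x) :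
    x ^ 2 * Real.exp (-(x ^ ε / 2)) ≤
      4 ^ ⌈3 / ε⌉₊ * (⌈3 / ε⌉₊).factorial * Real.exp (-(y ^ ε / 4)) / x := by
  set n := ⌈3 / ε⌉₊ with hn
  have hx : 1 ≤ x := hy.trans hxy
  have hx0 : 0 < x := by linarith
  have h1 : x ^ 3 ≤ (x ^ ε) ^ n := by
    rw [← Real.rpow_natCast (x ^ ε), ← Real.rpow_mul hx0.le, ← Real.rpow_natCast x 3]
    refine Real.rpow_le_rpow_of_exponent_le hx ?_
    have : 3 / ε ≤ n := Nat.le_ceil _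
    rw [div_le_iff₀ hε] at this
    push_cast
    linarith
  have h2 : (x ^ ε / 4) ^ n / n.factorial ≤ Real.exp (x ^ ε / 4) :=
    Real.pow_div_factorial_le_exp _ (by positivity) n
  rw [div_pow, div_div, div_le_iff₀ (by positivity)] at h2
  have h3 : y ^ ε ≤ x ^ ε := Real.rpow_le_rpow (by linarith) hxy hε.le
  rw [le_div_iff₀ hx0]
  calc x ^ 2 * Real.exp (-(x ^ ε / 2)) * x
      = x ^ 3 * (Real.exp (-(x ^ ε / 4)) * Real.exp (-(x ^ ε / 4))) := by
        rw [← Real.exp_add]; ring_nf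
    _ ≤ (Real.exp (x ^ ε / 4) * (4 ^ n * n.factorial)) *
        (Real.exp (-(x ^ ε / 4)) * Real.exp (-(y ^ ε / 4))) := by
        gcongr
        exact h1.trans h2
    _ = 4 ^ n * n.factorial * Real.exp (-(y ^ ε / 4)) *
        (Real.exp (x ^ ε / 4) * Real.exp (-(x ^ ε / 4))) := by ring
    _ = _ := by rw [← Real.exp_add, add_neg_cancel, Real.exp_zero, mul_one]

theorem sampleMeasure_goodSet_compl_le (hA : 0 < A) (hAM : A ≤ M) (hM : 2 ≤ M) {ε : ℝ}
    (hε : 0 < ε) :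
    sampleMeasure M A (goodSet M A ε)ᶜ ≤ ENNReal.ofReal
      (4 * (4 ^ ⌈3 / ε⌉₊ * (⌈3 / ε⌉₊).factorial) * Real.exp (-((M : ℝ) ^ ε / 4))) := by
  have hMr : (2 : ℝ) ≤ M := by exact_mod_cast hM
  have hAr : (0 : ℝ) < A := by exact_mod_cast hA
  set K : ℝ := 4 * (4 ^ ⌈3 / ε⌉₊ * (⌈3 / ε⌉₊).factorial) * Real.exp (-((M : ℝ) ^ ε / 4)) with hK
  have hK0 : 0 ≤ K := by positivity
  have hj : ∀ j : ℕ, sampleMeasure M A (⋃ m ∈ Finset.range ((M ^ (j + 1)) ^ 2),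
      {ω | 2 * √((A : ℝ) ^ (j + 1) * ((M : ℝ) ^ (j + 1)) ^ ε) ≤
        ‖deviation ω j (2 * Real.pi / (M : ℝ) ^ (j + 1) * m)‖}) ≤
      ENNReal.ofReal (K / 2 / 2 ^ j) := by
    intro j
    refine (measure_biUnion_finset_le _ _).trans ?_
    refine (Finset.sum_le_sum fun m _ =>
      sampleMeasure_deviation_tail hAM j _ (Real.sqrt_nonneg _)).trans ?_
    rw [Finset.sum_const, Finset.card_range, nsmul_eq_mul, ← ENNReal.ofReal_natCast,
      ← ENNReal.ofReal_mul (by positivity)]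
    refine ENNReal.ofReal_le_ofReal ?_
    rw [Real.sq_sqrt (by positivity)]
    have e : (A : ℝ) ^ (j + 1) * ((M : ℝ) ^ (j + 1)) ^ ε / (2 * (A : ℝ) ^ (j + 1)) =
        ((M : ℝ) ^ (j + 1)) ^ ε / 2 := by field_simp
    rw [e]
    have hMx : (M : ℝ) ≤ (M : ℝ) ^ (j + 1) := le_self_pow₀ (by linarith) (by omega)
    have h := sq_mul_exp_le hε (by linarith) hMx
    have h2 : (2 : ℝ) ^ (j + 1) ≤ (M : ℝ) ^ (j + 1) := by gcongr
    calc _ = 4 * (((M : ℝ) ^ (j + 1)) ^ 2 * Real.exp (-(((M : ℝ) ^ (j + 1)) ^ ε / 2))) := by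
          push_cast; ring
      _ ≤ 4 * (4 ^ ⌈3 / ε⌉₊ * (⌈3 / ε⌉₊).factorial * Real.exp (-((M : ℝ) ^ ε / 4)) /
          (M : ℝ) ^ (j + 1)) := by gcongr
      _ = K / (M : ℝ) ^ (j + 1) := by rw [hK]; ring
      _ ≤ K / 2 ^ (j + 1) := by gcongr
      _ = K / 2 / 2 ^ j := by rw [pow_succ]; field_simp
  have hcompl : (goodSet M A ε)ᶜ = ⋃ j : ℕ, ⋃ m ∈ Finset.range ((M ^ (j + 1)) ^ 2),
      {ω | 2 * √((A : ℝ) ^ (j + 1) * ((M : ℝ) ^ (j + 1)) ^ ε) ≤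
        ‖deviation ω j (2 * Real.pi / (M : ℝ) ^ (j + 1) * m)‖} := by
    simp only [goodSet, Set.compl_iInter, compl_compl]
  rw [hcompl]
  refine (measure_iUnion_le _).trans ((ENNReal.tsum_le_tsum hj).trans (le_of_eq ?_))
  rw [← ENNReal.ofReal_tsum_of_nonneg (fun j => by positivity) (summable_geometric_two' K),
    tsum_geometric_two']

theorem norm_deviation_le_of_mem_goodSet (hM : 0 < M) {ε : ℝ} {ω : SampleSpace M A}
    (hω : ω ∈ goodSet M A ε) (j : ℕ) (ξ : ℝ) :
    ‖deviation ω j ξ‖ ≤ 2 * √((A : ℝ) ^ (j + 1) * ((M : ℝ) ^ (j + 1)) ^ ε) +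
      2 * (A : ℝ) ^ (j + 1) * (2 * Real.pi / (M : ℝ) ^ (j + 1)) := by
  obtain ⟨m, hm, h⟩ := exists_norm_deviation_le hM ω j ξ
  simp only [goodSet, Set.mem_iInter, Set.mem_compl_iff, Set.mem_ofPred_eq, not_le] at hω
  linarith [hω j m (Finset.mem_range.mpr hm)]

/-- On the good set, the normalized deviations decay at the rate given by the exponent. -/
theorem norm_deviation_div_le_of_mem_goodSet (hM : 1 < M) {δ ε : ℝ}
    (hA : (A : ℝ) = (M : ℝ) ^ δ) (hδε : δ - ε ≤ 1) {ω : SampleSpace M A}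
    (hω : ω ∈ goodSet M A ε) (j : ℕ) (ξ : ℝ) :
    ‖deviation ω j ξ‖ / (A : ℝ) ^ (j + 1) ≤ 16 * ((M : ℝ) ^ (j + 1)) ^ (-((δ - ε) / 2)) := by
  have hMr : (1 : ℝ) < M := by exact_mod_cast hM
  have hM0 : (0 : ℝ) < M := by linarith
  set x : ℝ := (M : ℝ) ^ (j + 1) with hx
  have hx1 : 1 ≤ x := one_le_pow₀ hMr.le
  have hx0 : 0 < x := by linarith
  have hAx : (A : ℝ) ^ (j + 1) = x ^ δ := by
    rw [hA, hx, ← Real.rpow_natCast, ← Real.rpow_natCast, ← Real.rpow_mul hM0.le,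
      ← Real.rpow_mul hM0.le, mul_comm]
  have h := norm_deviation_le_of_mem_goodSet (by omega) hω j ξ
  rw [← hx, hAx] at h
  rw [hAx, div_le_iff₀ (by positivity)]
  have e1 : √(x ^ δ * x ^ ε) = x ^ (-((δ - ε) / 2)) * x ^ δ := by
    rw [Real.sqrt_eq_rpow, ← Real.rpow_add hx0, ← Real.rpow_add hx0, ← Real.rpow_mul hx0.le]
    ring_nf
  have e2 : x⁻¹ ≤ x ^ (-((δ - ε) / 2)) := by
    rw [← Real.rpow_neg_one]
    exact Real.rpow_le_rpow_of_exponent_le hx1 (by linarith)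
  have hpi : Real.pi ≤ 3.5 := by linarith [Real.pi_lt_d2]
  -- The discretization error contributes `4π ≤ 14`, which with the `2` from the tail threshold
  -- makes `16`.
  have e3 : 2 * x ^ δ * (2 * Real.pi / x) ≤ 14 * (x ^ (-((δ - ε) / 2)) * x ^ δ) := by
    calc _ = 4 * Real.pi * (x⁻¹ * x ^ δ) := by rw [div_eq_mul_inv]; ring
      _ ≤ 4 * 3.5 * (x ^ (-((δ - ε) / 2)) * x ^ δ) := by gcongr
      _ = _ := by norm_num
  rw [e1] at h
  linarith

end RandomCantor

namespace RandomCantor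

variable {M A : ℕ}

/-! ### The Fourier transforms of the approximating measures -/

theorem cantorApprox_eq_iUnion (ω : SampleSpace M A) (j : ℕ) :
    cantorApprox ω j =
      ⋃ k, Set.Icc (leftEndpoint ω j k) (leftEndpoint ω j k + 1 / (M : ℝ) ^ j) := by
  simp only [cantorApprox, leftEndpoints, Set.biUnion_range]

/-- The intervals overlap at most in endpoints, by `leftEndpoint_add_le`. -/
theorem approxMeasure_eq_sum (ω : SampleSpace M A) (j : ℕ) :
    approxMeasure ω j = ENNReal.ofReal ((M : ℝ) ^ j / (A : ℝ) ^ j) • ∑ k,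
      volume.restrict (Set.Icc (leftEndpoint ω j k) (leftEndpoint ω j k + 1 / (M : ℝ) ^ j)) := by
  have hdisj : Pairwise (Function.onFun (AEDisjoint (volume : Measure ℝ)) fun k =>
      Set.Icc (leftEndpoint ω j k) (leftEndpoint ω j k + 1 / (M : ℝ) ^ j)) := by
    have key : ∀ k k' : Fin (A ^ j), k < k' → AEDisjoint (volume : Measure ℝ)
        (Set.Icc (leftEndpoint ω j k) (leftEndpoint ω j k + 1 / (M : ℝ) ^ j))
        (Set.Icc (leftEndpoint ω j k') (leftEndpoint ω j k' + 1 / (M : ℝ) ^ j)) := by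
      intro k k' hk
      have h := leftEndpoint_add_le ω j hk
      refine measure_mono_null (t := {leftEndpoint ω j k'}) ?_ (by simp)
      rintro x ⟨⟨_, h2⟩, h3, _⟩
      exact le_antisymm (h2.trans h) h3
    intro k k' hk
    rcases hk.lt_or_gt with h | h
    · exact key k k' h
    · exact (key k' k h).symm
  rw [approxMeasure, cantorApprox_eq_iUnion,
    withDensity_indicator (MeasurableSet.iUnion fun k => measurableSet_Icc),
    withDensity_const, Measure.restrict_iUnion_ae hdisj fun k =>
      measurableSet_Icc.nullMeasurableSet, Measure.sum_fintype]

theorem isProbabilityMeasure_approxMeasure (hM : 0 < M) (hA : 0 < A) (ω : SampleSpace M A)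
    (j : ℕ) : IsProbabilityMeasure (approxMeasure ω j) := by
  have hMr : (0 : ℝ) < M := by exact_mod_cast hM
  have hAr : (0 : ℝ) < A := by exact_mod_cast hA
  constructor
  rw [approxMeasure_eq_sum]
  simp only [Measure.smul_apply, Measure.finsetSum_apply, Measure.restrict_apply_univ,
    Real.volume_Icc, add_sub_cancel_left, Finset.sum_const, Finset.card_univ, Fintype.card_fin,
    smul_eq_mul, nsmul_eq_mul]
  rw [← ENNReal.ofReal_natCast, ← ENNReal.ofReal_mul (by positivity),
    ← ENNReal.ofReal_mul (by positivity), ENNReal.ofReal_eq_one]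
  push_cast
  field_simp

theorem approxMeasure_compl_Icc (hM : 0 < M) (ω : SampleSpace M A) (j : ℕ) :
    approxMeasure ω j (Set.Icc 0 1)ᶜ = 0 := by
  rw [approxMeasure_eq_sum]
  simp only [Measure.smul_apply, Measure.finsetSum_apply, smul_eq_mul]
  rw [Finset.sum_eq_zero, mul_zero]
  intro k _
  rw [Measure.restrict_apply measurableSet_Icc.compl, ← Set.sdiff_eq_compl_inter,
    Set.sdiff_eq_empty.mpr, measure_empty]
  have h := leftEndpoint_mem_Icc hM ω j k
  exact Set.Icc_subset_Icc h.1 (by linarith [h.2])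

/-- The normalized Fourier transform of the interval `[0, M⁻ʲ]`. -/
noncomputable def intervalTransform (M j : ℕ) (ξ : ℝ) : ℂ :=
  (M : ℂ) ^ j * ∫ x in (0 : ℝ)..1 / (M : ℝ) ^ j, wave ξ x

theorem integral_wave_add (ξ b h : ℝ) :
    ∫ x in b..b + h, wave ξ x = wave ξ b * ∫ x in (0 : ℝ)..h, wave ξ x := by
  have e := intervalIntegral.integral_comp_add_left (a := 0) (b := h) (wave ξ) b
  rw [add_zero] at e
  rw [← e, ← intervalIntegral.integral_const_mul]
  simp only [wave_add]

theorem integral_wave_approxMeasure (ω : SampleSpace M A) (j : ℕ) (ξ : ℝ) :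
    ∫ x, wave ξ x ∂(approxMeasure ω j) =
      (∑ k, wave ξ (leftEndpoint ω j k)) / (A : ℂ) ^ j * intervalTransform M j ξ := by
  have h0 : (0 : ℝ) ≤ 1 / (M : ℝ) ^ j := by positivity
  rw [approxMeasure_eq_sum, integral_smul_measure, integral_finsetSum_measure]
  · simp only [integral_Icc_eq_integral_Ioc]
    simp_rw [← intervalIntegral.integral_of_le (le_add_of_nonneg_right h0), integral_wave_add]
    rw [← Finset.sum_mul, ENNReal.toReal_ofReal (by positivity), intervalTransform,
      Complex.real_smul]
    push_cast
    ring
  · intro k _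
    exact ((continuous_wave ξ).continuousOn.integrableOn_compact isCompact_Icc)

/-- The interval is cut into `M` translates of the next shorter one. This puts generations `j` and
`j + 1` over the same interval factor, so that they can be subtracted. -/
theorem intervalTransform_eq (hM : 0 < M) (j : ℕ) (ξ : ℝ) :
    intervalTransform M j ξ = (∑ a : Fin M, wave ξ (((a : ℕ) : ℝ) / (M : ℝ) ^ (j + 1))) / M *
      intervalTransform M (j + 1) ξ := by
  have hMr : (0 : ℝ) < M := by exact_mod_cast hM
  have hMc : (M : ℂ) ≠ 0 := by exact_mod_cast hM.ne'
  have h := intervalIntegral.sum_integral_adjacent_intervals (f := wave ξ) (μ := volume)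
    (a := fun n : ℕ => (n : ℝ) / (M : ℝ) ^ (j + 1)) (n := M)
    fun k _ => (continuous_wave ξ).intervalIntegrable _ _
  have e1 : ((M : ℕ) : ℝ) / (M : ℝ) ^ (j + 1) = 1 / (M : ℝ) ^ j := by
    rw [pow_succ]; field_simp
  simp only [Nat.cast_zero, zero_div, e1] at h
  have e2 : ∀ k : ℕ, ((k + 1 : ℕ) : ℝ) / (M : ℝ) ^ (j + 1) =
      (k : ℝ) / (M : ℝ) ^ (j + 1) + 1 / (M : ℝ) ^ (j + 1) := fun k => by
    push_cast; rw [add_div]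
  simp only [e2, integral_wave_add] at h
  rw [intervalTransform, intervalTransform, ← h, ← Finset.sum_mul,
    Finset.sum_range fun k => wave ξ ((k : ℝ) / (M : ℝ) ^ (j + 1)), pow_succ (M : ℂ)]
  field_simp

theorem norm_intervalTransform_le_one (hM : 0 < M) (j : ℕ) (ξ : ℝ) :
    ‖intervalTransform M j ξ‖ ≤ 1 := by
  have hMr : (0 : ℝ) < M := by exact_mod_cast hM
  have h := intervalIntegral.norm_integral_le_of_norm_le_const (a := 0) (b := 1 / (M : ℝ) ^ j)
    (f := wave ξ) (C := 1) fun x _ => (norm_wave ξ x).le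
  rw [sub_zero, abs_of_nonneg (by positivity), one_mul] at h
  rw [intervalTransform, norm_mul, norm_pow, Complex.norm_natCast]
  calc _ ≤ (M : ℝ) ^ j * (1 / (M : ℝ) ^ j) := by gcongr
    _ = 1 := by field_simp

theorem norm_intervalTransform_le_div (j : ℕ) {ξ : ℝ} (hξ : ξ ≠ 0) :
    ‖intervalTransform M j ξ‖ ≤ 2 * (M : ℝ) ^ j / |ξ| := by
  have hc : -Complex.I * ξ ≠ 0 := by simp [hξ]
  have h : ∫ x in (0 : ℝ)..1 / (M : ℝ) ^ j, wave ξ x =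
      (wave ξ (1 / (M : ℝ) ^ j) - wave ξ 0) / (-Complex.I * ξ) := by
    have e := integral_exp_mul_complex (a := 0) (b := 1 / (M : ℝ) ^ j) hc
    have e2 : ∀ x : ℝ, wave ξ x = Complex.exp (-Complex.I * ξ * x) := fun x => by
      rw [wave]; ring_nf
    simp only [e2]
    exact e
  rw [intervalTransform, h, norm_mul, norm_pow, Complex.norm_natCast, norm_div, norm_mul,
    norm_neg, Complex.norm_I, one_mul, Complex.norm_real, Real.norm_eq_abs]
  have h2 : ‖wave ξ (1 / (M : ℝ) ^ j) - wave ξ 0‖ ≤ 2 := by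
    refine (norm_sub_le _ _).trans ?_
    rw [norm_wave, norm_wave]; norm_num
  calc _ ≤ (M : ℝ) ^ j * (2 / |ξ|) := by gcongr
    _ = _ := by ring

/-- The second summand is the conditional expectation: by translation, the average over all `M`
digits is the same factor for every parent interval. -/
theorem sum_wave_leftEndpoint_succ (ω : SampleSpace M A) (j : ℕ) (ξ : ℝ) :
    ∑ k, wave ξ (leftEndpoint ω (j + 1) k) = deviation ω j ξ +
      A * (∑ p, wave ξ (leftEndpoint ω j p)) *
        ((∑ a : Fin M, wave ξ (((a : ℕ) : ℝ) / (M : ℝ) ^ (j + 1))) / M) := by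
  have h1 : ∑ k, wave ξ (leftEndpoint ω (j + 1) k) =
      ∑ p, ∑ a ∈ (ω j p).1, wave ξ (child ω j p a) := by
    have e : ∑ k : Fin (A ^ j * A), wave ξ (leftEndpoint ω (j + 1) k) =
        ∑ q : Fin (A ^ j) × Fin A, wave ξ (child ω j q.1 ((ω j q.1).digit q.2)) :=
      Fintype.sum_equiv finProdFinEquiv.symm _ _ fun k => rfl
    refine e.trans ?_
    rw [Fintype.sum_prod_type]
    refine Finset.sum_congr rfl fun p _ => ?_
    have hr := Finset.map_orderEmbOfFin_univ (ω j p).1 (ω j p).2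
    conv_rhs => rw [← hr, Finset.sum_map]
    rfl
  have h2 : ∀ p : Fin (A ^ j), ∑ a, wave ξ (child ω j p a) =
      wave ξ (leftEndpoint ω j p) *
        ∑ a : Fin M, wave ξ (((a : ℕ) : ℝ) / (M : ℝ) ^ (j + 1)) := fun p => by
    simp only [child, wave_add, Finset.mul_sum]
  rw [h1, deviation, Finset.sum_sub_distrib]
  simp only [h2]
  rw [Finset.mul_sum, Finset.sum_mul, sub_add_eq_add_sub, eq_sub_iff_add_eq]
  congr 1
  exact Finset.sum_congr rfl fun p _ => by ring

/-- The Fourier transforms of the approximating measures form a martingale, with differences given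
by the deviations. -/
theorem integral_wave_approxMeasure_succ (hM : 0 < M) (hA : 0 < A) (ω : SampleSpace M A) (j : ℕ)
    (ξ : ℝ) :
    ∫ x, wave ξ x ∂(approxMeasure ω (j + 1)) = ∫ x, wave ξ x ∂(approxMeasure ω j) +
      deviation ω j ξ / (A : ℂ) ^ (j + 1) * intervalTransform M (j + 1) ξ := by
  have hAc : (A : ℂ) ≠ 0 := by exact_mod_cast hA.ne'
  rw [integral_wave_approxMeasure, integral_wave_approxMeasure, intervalTransform_eq hM j,
    sum_wave_leftEndpoint_succ, pow_succ (A : ℂ)]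
  field_simp
  ring

theorem integral_wave_approxMeasure_zero (ω : SampleSpace M A) (ξ : ℝ) :
    ∫ x, wave ξ x ∂(approxMeasure ω 0) = intervalTransform M 0 ξ := by
  rw [integral_wave_approxMeasure]
  simp only [leftEndpoint, Finset.sum_const, Finset.card_univ, Fintype.card_fin]
  simp [wave]

end RandomCantor

namespace RandomCantor

variable {M A : ℕ}

/-! ### The weak limit and its Fourier decay -/

theorem charFun_eq_integral_wave (μ : Measure ℝ) (t : ℝ) :
    charFun μ t = ∫ x, wave (-t) x ∂μ := by
  rw [charFun_apply_real]
  congr 1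
  ext x
  rw [wave]
  push_cast
  ring_nf

/-- Probability measures on a fixed compact set whose characteristic functions converge pointwise
have a weak limit. -/
theorem exists_tendsto_of_tendsto_charFun {μ : ℕ → ProbabilityMeasure ℝ} {K : Set ℝ}
    (hK : IsCompact K) (hμ : ∀ n, (μ n : Measure ℝ) Kᶜ = 0) {F : ℝ → ℂ}
    (hF : ∀ t, Tendsto (fun n => charFun (μ n : Measure ℝ) t) atTop (𝓝 (F t))) :
    ∃ ν : ProbabilityMeasure ℝ, Tendsto μ atTop (𝓝 ν) ∧
      ∀ t, charFun (ν : Measure ℝ) t = F t := by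
  have htight : IsTightMeasureSet
      {((m : ProbabilityMeasure ℝ) : Measure ℝ) | m ∈ Set.range μ} := by
    rw [isTightMeasureSet_iff_exists_isCompact_measure_compl_le]
    intro r _
    refine ⟨K, hK, ?_⟩
    rintro _ ⟨_, ⟨n, rfl⟩, rfl⟩
    rw [hμ n]
    exact zero_le
  -- Compactness is needed only to produce some measure with characteristic function `F`; Lévy's
  -- continuity theorem then gives convergence of the whole sequence.
  have hcomp := isCompact_closure_of_isTightMeasureSet htight
  obtain ⟨ν, -, hν⟩ := hcomp.ultrafilter_le_nhds ((Ultrafilter.of (atTop : Filter ℕ)).map μ)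
    (.trans (by simp) (monotone_principal subset_closure))
  have hν' : Tendsto μ (Ultrafilter.of (atTop : Filter ℕ)) (𝓝 ν) := hν
  have hchar : ∀ t, charFun (ν : Measure ℝ) t = F t := by
    intro t
    refine tendsto_nhds_unique ?_ ((hF t).mono_left (Ultrafilter.of_le atTop))
    rw [ProbabilityMeasure.tendsto_iff_forall_integral_rclike_tendsto ℂ] at hν'
    simp_rw [charFun_eq_integral_innerProbChar]
    exact hν' (BoundedContinuousFunction.innerProbChar t)
  refine ⟨ν, ProbabilityMeasure.tendsto_of_tendsto_charFun fun t => ?_, hchar⟩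
  rw [hchar t]
  exact hF t

/-- The subtractions are truncated, so only one summand of the exponent is active on each side of
`k`; each side contributes at most `2`. -/
theorem sum_range_two_sided_geometric_le (k n : ℕ) :
    ∑ J ∈ Finset.range n, (1 / 2 : ℝ) ^ ((k - J) + (J - (k + 1))) ≤ 4 := by
  have h1 : ∑ J ∈ Finset.range (k + 1), (1 / 2 : ℝ) ^ ((k - J) + (J - (k + 1))) ≤ 2 := by
    refine le_trans (le_of_eq ?_) (sum_geometric_two_le (k + 1))
    rw [← Finset.sum_range_reflect]
    refine Finset.sum_congr rfl fun J hJ => ?_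
    have := Finset.mem_range.mp hJ
    congr 1
    omega
  have h2 : ∑ J ∈ Finset.range n, (1 / 2 : ℝ) ^ ((k - (k + 1 + J)) + (k + 1 + J - (k + 1))) ≤
      2 := by
    refine le_trans (le_of_eq ?_) (sum_geometric_two_le n)
    refine Finset.sum_congr rfl fun J _ => ?_
    congr 1
    omega
  have h3 : ∑ J ∈ Finset.range n, (1 / 2 : ℝ) ^ ((k - J) + (J - (k + 1))) ≤
      ∑ J ∈ Finset.range (k + 1 + n), (1 / 2 : ℝ) ^ ((k - J) + (J - (k + 1))) :=
    Finset.sum_le_sum_of_subset_of_nonneg (Finset.range_mono (by omega))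
      fun _ _ _ => by positivity
  rw [Finset.sum_range_add] at h3
  linarith

/-- The geometric series of the scales up to and beyond a frequency `X`. -/
theorem sum_min_mul_rpow_le {m X α : ℝ} (hm : 1 < m) (hX : 1 ≤ X) (hα : 0 < α) (hα' : α ≤ 1 / 2)
    (hmα : 2 ≤ m ^ α) (n : ℕ) :
    ∑ J ∈ Finset.range n, min 1 (2 * m ^ J / X) * (m ^ J) ^ (-α) ≤ 8 * X ^ (-α) := by
  have hm0 : 0 < m := by linarith
  have hX0 : 0 < X := by linarith
  obtain ⟨k, hk1, hk2⟩ := exists_nat_pow_near hX hm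
  have hterm : ∀ J : ℕ, min 1 (2 * m ^ J / X) * (m ^ J) ^ (-α) ≤
      2 * X ^ (-α) * (1 / 2) ^ ((k - J) + (J - (k + 1))) := by
    intro J
    have hy : 0 < m ^ J := by positivity
    rcases le_or_gt J k with hJ | hJ
    -- Scales up to `X`: the bound `2 m^J / X` leaves `(m^J / X)^(1-α)`, with ratio at most `1/2`
    -- because `m^(1-α) ≥ m^α ≥ 2`.
    · have e0 : J - (k + 1) = 0 := by omega
      rw [e0, add_zero]
      obtain ⟨i, rfl⟩ : ∃ i, k = J + i := ⟨k - J, by omega⟩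
      rw [Nat.add_sub_cancel_left]
      have hq : m ^ J / X ≤ (m⁻¹) ^ i := by
        rw [inv_pow, ← one_div, div_le_div_iff₀ hX0 (by positivity), one_mul, ← pow_add]
        exact hk1
      have hm2 : m⁻¹ ^ (1 - α) ≤ 1 / 2 := by
        rw [Real.inv_rpow hm0.le, ← one_div]
        refine one_div_le_one_div_of_le two_pos (hmα.trans ?_)
        exact Real.rpow_le_rpow_of_exponent_le hm.le (by linarith)
      have hq2 : (m ^ J / X) ^ (1 - α) ≤ (1 / 2) ^ i := by
        calc _ ≤ ((m⁻¹) ^ i) ^ (1 - α) := Real.rpow_le_rpow (by positivity) hq (by linarith)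
          _ = (m⁻¹ ^ (1 - α)) ^ i := by
            rw [← Real.rpow_natCast, ← Real.rpow_mul (by positivity), mul_comm,
              Real.rpow_mul (by positivity), Real.rpow_natCast]
          _ ≤ _ := by gcongr
      calc _ ≤ (2 * m ^ J / X) * (m ^ J) ^ (-α) := by
            gcongr
            exact min_le_right _ _
        _ = 2 * X ^ (-α) * (m ^ J / X) ^ (1 - α) := by
            rw [Real.div_rpow hy.le hX0.le, sub_eq_add_neg, Real.rpow_add hy,
              Real.rpow_add hX0, Real.rpow_one, Real.rpow_one]
            have := (Real.rpow_pos_of_pos hX0 (-α)).ne'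
            field_simp
        _ ≤ _ := by gcongr
    -- Scales beyond `X`: the bound `1` suffices, and `m^(-α) ≤ 1/2` is the ratio.
    · have e0 : k - J = 0 := by omega
      rw [e0, zero_add]
      obtain ⟨i, rfl⟩ : ∃ i, J = k + 1 + i := ⟨J - (k + 1), by omega⟩
      rw [Nat.add_sub_cancel_left]
      have hq : X * m ^ i ≤ m ^ (k + 1 + i) := by
        rw [pow_add m (k + 1)]
        gcongr
      have hm2 : m ^ (-α) ≤ 1 / 2 := by
        rw [Real.rpow_neg hm0.le, ← one_div]
        exact one_div_le_one_div_of_le two_pos hmα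
      calc _ ≤ 1 * (m ^ (k + 1 + i)) ^ (-α) := by
            gcongr
            exact min_le_left _ _
        _ ≤ 1 * (X * m ^ i) ^ (-α) := by
            rw [one_mul, one_mul]
            exact Real.rpow_le_rpow_of_nonpos (by positivity) hq (by linarith)
        _ = X ^ (-α) * (m ^ (-α)) ^ i := by
            rw [Real.mul_rpow hX0.le (by positivity), one_mul, ← Real.rpow_natCast,
              ← Real.rpow_mul hm0.le, mul_comm (i : ℝ), Real.rpow_mul hm0.le,
              Real.rpow_natCast]
        _ ≤ X ^ (-α) * (1 / 2) ^ i := by gcongr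
        _ ≤ _ := by
            have : 0 ≤ X ^ (-α) * (1 / 2) ^ i := by positivity
            linarith
  refine (Finset.sum_le_sum fun J _ => hterm J).trans ?_
  rw [← Finset.mul_sum]
  have := sum_range_two_sided_geometric_le k n
  have h0 : 0 ≤ 2 * X ^ (-α) := by positivity
  nlinarith

theorem norm_integral_wave_approxMeasure_sub_le (hM : 1 < M) (hA0 : 0 < A) {δ ε : ℝ}
    (hA : (A : ℝ) = (M : ℝ) ^ δ) (hδε : δ - ε ≤ 1) {ω : SampleSpace M A}
    (hω : ω ∈ goodSet M A ε) (j : ℕ) (ξ : ℝ) :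
    ‖∫ x, wave ξ x ∂(approxMeasure ω (j + 1)) - ∫ x, wave ξ x ∂(approxMeasure ω j)‖ ≤
      16 * ((M : ℝ) ^ (j + 1)) ^ (-((δ - ε) / 2)) * ‖intervalTransform M (j + 1) ξ‖ := by
  rw [integral_wave_approxMeasure_succ (by omega) hA0, add_sub_cancel_left, norm_mul, norm_div,
    norm_pow, Complex.norm_natCast]
  gcongr
  exact norm_deviation_div_le_of_mem_goodSet hM hA hδε hω j ξ

theorem tendsto_integral_wave_approxMeasure (hM : 1 < M) (hA0 : 0 < A) {δ ε : ℝ}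
    (hA : (A : ℝ) = (M : ℝ) ^ δ) (hδε : δ - ε ≤ 1) (hεδ : ε < δ) {ω : SampleSpace M A}
    (hω : ω ∈ goodSet M A ε) (ξ : ℝ) :
    ∃ z, Tendsto (fun j => ∫ x, wave ξ x ∂(approxMeasure ω j)) atTop (𝓝 z) := by
  have hMr : (1 : ℝ) < M := by exact_mod_cast hM
  have hM0 : (0 : ℝ) < M := by linarith
  set r : ℝ := (M : ℝ) ^ (-((δ - ε) / 2)) with hr
  have hr1 : r < 1 := Real.rpow_lt_one_of_one_lt_of_neg hMr (by linarith)
  refine cauchySeq_tendsto_of_complete (cauchySeq_of_le_geometric r (16 * r) hr1 fun j => ?_)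
  rw [dist_comm, dist_eq_norm]
  refine (norm_integral_wave_approxMeasure_sub_le hM hA0 hA hδε hω j ξ).trans ?_
  have e : ((M : ℝ) ^ (j + 1)) ^ (-((δ - ε) / 2)) = r ^ (j + 1) := by
    rw [hr, ← Real.rpow_natCast, ← Real.rpow_natCast, ← Real.rpow_mul hM0.le,
      ← Real.rpow_mul hM0.le, mul_comm]
  rw [e]
  have h1 := norm_intervalTransform_le_one (M := M) (by omega) (j + 1) ξ
  calc _ ≤ 16 * r ^ (j + 1) * 1 := by gcongr
    _ = _ := by rw [pow_succ]; ring

theorem norm_integral_wave_approxMeasure_le (hM : 1 < M) (hA0 : 0 < A) {δ ε : ℝ}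
    (hA : (A : ℝ) = (M : ℝ) ^ δ) (hδε : δ - ε ≤ 1) (hεδ : ε < δ)
    (hM2 : 2 ≤ (M : ℝ) ^ ((δ - ε) / 2)) {ω : SampleSpace M A}
    (hω : ω ∈ goodSet M A ε) {ξ : ℝ} (hξ : 1 ≤ |ξ|) (j : ℕ) :
    ‖∫ x, wave ξ x ∂(approxMeasure ω j)‖ ≤ 128 * |ξ| ^ (-((δ - ε) / 2)) := by
  have hMr : (1 : ℝ) < M := by exact_mod_cast hM
  have hξ0 : ξ ≠ 0 := by rintro rfl; norm_num at hξ
  have hT : ∀ J, ‖intervalTransform M J ξ‖ ≤ min 1 (2 * (M : ℝ) ^ J / |ξ|) := fun J =>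
    le_min (norm_intervalTransform_le_one (by omega) J ξ) (norm_intervalTransform_le_div J hξ0)
  -- The increments are telescoped; the term `J = 0` accounts for the initial measure `ν_0`.
  have h : ‖∫ x, wave ξ x ∂(approxMeasure ω j)‖ ≤ 16 * ∑ J ∈ Finset.range (j + 1),
      min 1 (2 * (M : ℝ) ^ J / |ξ|) * ((M : ℝ) ^ J) ^ (-((δ - ε) / 2)) := by
    induction j with
    | zero =>
      rw [integral_wave_approxMeasure_zero]
      have h0 := hT 0
      have h1 := norm_nonneg (intervalTransform M 0 ξ)
      simp only [zero_add, Finset.sum_range_one, pow_zero, Real.one_rpow, mul_one] at h0 ⊢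
      linarith
    | succ j ih =>
      rw [Finset.sum_range_succ, mul_add]
      have h1 := norm_le_norm_add_norm_sub (∫ x, wave ξ x ∂(approxMeasure ω j))
        (∫ x, wave ξ x ∂(approxMeasure ω (j + 1)))
      have h2 := norm_integral_wave_approxMeasure_sub_le hM hA0 hA hδε hω j ξ
      have h3 : 16 * ((M : ℝ) ^ (j + 1)) ^ (-((δ - ε) / 2)) * ‖intervalTransform M (j + 1) ξ‖ ≤
          16 * (min 1 (2 * (M : ℝ) ^ (j + 1) / |ξ|) *
            ((M : ℝ) ^ (j + 1)) ^ (-((δ - ε) / 2))) := by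
        rw [mul_assoc, mul_comm (min _ _)]
        gcongr
        exact hT _
      have h4 := norm_sub_rev (∫ x, wave ξ x ∂(approxMeasure ω j))
        (∫ x, wave ξ x ∂(approxMeasure ω (j + 1)))
      linarith
  have h2 := sum_min_mul_rpow_le hMr hξ (α := (δ - ε) / 2) (by linarith) (by linarith) hM2 (j + 1)
  linarith

theorem exists_isCantorMeasure (hM : 1 < M) (hA0 : 0 < A) {δ ε : ℝ}
    (hA : (A : ℝ) = (M : ℝ) ^ δ) (hδε : δ - ε ≤ 1) (hεδ : ε < δ)
    (hM2 : 2 ≤ (M : ℝ) ^ ((δ - ε) / 2)) {ω : SampleSpace M A} (hω : ω ∈ goodSet M A ε) :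
    ∃ ν : Measure ℝ, IsCantorMeasure ω ν ∧ ∀ ξ : ℝ, 1 ≤ |ξ| →
      ‖fourierTransform ν ξ‖ ≤ 128 * |ξ| ^ (-((δ - ε) / 2)) := by
  choose F hF using fun ξ => tendsto_integral_wave_approxMeasure hM hA0 hA hδε hεδ hω ξ
  let μ : ℕ → ProbabilityMeasure ℝ := fun j =>
    ⟨approxMeasure ω j, isProbabilityMeasure_approxMeasure (by omega) hA0 ω j⟩
  obtain ⟨ν, hν, hchar⟩ := exists_tendsto_of_tendsto_charFun (μ := μ) isCompact_Icc
    (fun j => approxMeasure_compl_Icc (by omega) ω j) (F := fun t => F (-t)) fun t => by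
      simp only [charFun_eq_integral_wave]
      exact hF (-t)
  refine ⟨ν, ⟨inferInstance, ?_⟩, fun ξ hξ => ?_⟩
  · exact ProbabilityMeasure.tendsto_iff_forall_integral_tendsto.mp hν
  · have h1 : ‖F ξ‖ ≤ 128 * |ξ| ^ (-((δ - ε) / 2)) :=
      le_of_tendsto (hF ξ).norm (Eventually.of_forall fun j =>
        norm_integral_wave_approxMeasure_le hM hA0 hA hδε hεδ hM2 hω hξ j)
    have h2 : ∫ x, wave ξ x ∂(ν : Measure ℝ) = F ξ := by
      have h := hchar (-ξ)
      rwa [charFun_eq_integral_wave, neg_neg] at h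
    have h3 : 1 / √(2 * Real.pi) ≤ 1 := by
      rw [div_le_one (by positivity), Real.one_le_sqrt]
      linarith [Real.pi_gt_three]
    change ‖((1 / √(2 * Real.pi) : ℝ) : ℂ) * ∫ x, wave ξ x ∂(ν : Measure ℝ)‖ ≤ _
    rw [h2, norm_mul, Complex.norm_real, Real.norm_of_nonneg (by positivity)]
    exact (mul_le_of_le_one_left (norm_nonneg _) h3).trans h1

end RandomCantor

theorem theorem1p3 :
    ∃ C : ℝ, 0 < C ∧
      ∀ ε : ℝ, 0 < ε →
        ∃ C₁ : ℝ, 0 < C₁ ∧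
          ∀ (δ : ℝ) (M A : ℕ), 0 < δ → δ < 1 →
            Real.exp (4 / δ) ≤ (M : ℝ) → (A : ℝ) = (M : ℝ) ^ δ →
            ε < min (δ / 2) (1 / 3) →
              ∃ G : Set (RandomCantor.SampleSpace M A), MeasurableSet G ∧
                RandomCantor.sampleMeasure M A Gᶜ ≤ ENNReal.ofReal (C₁ * Real.exp (-((M : ℝ) ^ ε / C))) ∧
                ∀ ω ∈ G, ∃ ν : Measure ℝ, RandomCantor.IsCantorMeasure ω ν ∧
                  ∀ ξ : ℝ, (M : ℝ) ^ 4 ≤ |ξ| →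
                    ‖RandomCantor.fourierTransform ν ξ‖ ≤ C * |ξ| ^ (-((δ - ε) / 2)) := by
  -- `128 = 16 · 8`, from the deviation bound and the geometric series. It also serves in the
  -- probability bound, where `4` would do.
  refine ⟨128, by norm_num, fun ε hε =>
    ⟨4 * (4 ^ ⌈3 / ε⌉₊ * (⌈3 / ε⌉₊).factorial), by positivity, ?_⟩⟩
  intro δ M A hδ hδ1 hM hA hεδ
  have hεδ2 : ε < δ / 2 := hεδ.trans_le (min_le_left _ _)
  have he2 : (2 : ℝ) ≤ Real.exp 1 := by linarith [Real.add_one_le_exp 1]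
  have hM1 : Real.exp 1 ≤ M :=
    (Real.exp_le_exp.mpr (by rw [le_div_iff₀ hδ]; linarith)).trans hM
  have hMr : (2 : ℝ) ≤ M := he2.trans hM1
  have hMn : 2 ≤ M := by exact_mod_cast hMr
  have hM0 : (0 : ℝ) < M := by linarith
  have hA0 : 0 < A := by
    have : (0 : ℝ) < A := by rw [hA]; positivity
    exact_mod_cast this
  have hAM : A ≤ M := by
    have : (A : ℝ) ≤ M := by
      rw [hA]
      exact (Real.rpow_le_rpow_of_exponent_le (by linarith) hδ1.le).trans_eq (Real.rpow_one _)
    exact_mod_cast this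
  -- The ratio condition: `M ≥ e^(4/δ)` gives `M^(δ/4) ≥ e ≥ 2`, and `ε < δ/2` gives `(δ-ε)/2 >
  -- δ/4`.
  have hM2 : 2 ≤ (M : ℝ) ^ ((δ - ε) / 2) := by
    calc (2 : ℝ) ≤ Real.exp 1 := he2
      _ = Real.exp (4 / δ) ^ (δ / 4) := by
        rw [← Real.exp_mul]
        congr 1
        field_simp
      _ ≤ (M : ℝ) ^ (δ / 4) := Real.rpow_le_rpow (Real.exp_nonneg _) hM (by linarith)
      _ ≤ _ := Real.rpow_le_rpow_of_exponent_le (by linarith) (by linarith)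
  refine ⟨RandomCantor.goodSet M A ε, RandomCantor.measurableSet_goodSet M A ε, ?_, ?_⟩
  · refine (RandomCantor.sampleMeasure_goodSet_compl_le hA0 hAM hMn hε).trans
      (ENNReal.ofReal_le_ofReal ?_)
    have : (0 : ℝ) ≤ (M : ℝ) ^ ε := by positivity
    gcongr
    norm_num
  · intro ω hω
    obtain ⟨ν, hν, h⟩ := RandomCantor.exists_isCantorMeasure (by omega) hA0 hA (by linarith)
      (by linarith) hM2 hω
    exact ⟨ν, hν, fun ξ hξ => h ξ (le_trans (one_le_pow₀ (by linarith)) hξ)⟩
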